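/- Let $d\ge 1$, let $X_1,X_2,\dots$ be i.i.d. $\mathbb{Z}^d$-valued random variables (with arbitrary common law), let $a\in\mathbb{Z}^d$, and let $S_k=a+\sum_{i=1}^k X_i$, $k\ge 0$, be the random walk started from $a$. For $z\in\mathbb{Z}^d$ let $\mathcal N(z)$ be the set of the $2d$ lattice points at Euclidean distance $1$ from $z$. Let $$L_n=\#\{S_i : 0\le i\le n,\ \mathcal N(S_i)\not\subset\{S_m\}_{m=0}^n\}$$ be the number of inner boundary points of the range $\{S_m\}_{m=0}^n$. Then $$\lim_{n\to\infty}\frac{L_n}{n}=q\quad\text{almost surely},$$ where $$q=P\Big(\mathcal N(0)\not\subset\{S^0_m\}_{m=0}^\infty\cup\{S'_m\}_{m=0}^\infty\ \text{ and }\ 0\notin\{S^0_m\}_{m=1}^\infty\Big),$$ $S^0_k=\sum_{i=1}^k X_i$ is the walk started from $0$, and $\{S'_m\}_{m\ge 0}$ is a copy of $\{-S^0_m\}_{m\ge 0}$ independent of $\{S^0_m\}_{m\ge 0}$. -/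

import Mathlib

open MeasureTheory ProbabilityTheory Filter Topology

namespace RangeBoundary

/-- The neighbours of `a` in the lattice `ℤ^d`: the points at (`ℓ¹`, equivalently Euclidean)
distance one from `a`. The metric that Mathlib puts on `Fin d → ℤ` is the sup metric, which is
not the one meant here. -/
def neighbors {d : ℕ} (a : Fin d → ℤ) : Set (Fin d → ℤ) :=
  {z | ∑ i, |z i - a i| = 1}

/-- The walk `S_k = a + X_1 + ⋯ + X_k` started from `a`, as a path; the increment `X_{i+1}` is
`x i`. -/
def walk {d : ℕ} (a : Fin d → ℤ) (x : ℕ → Fin d → ℤ) (k : ℕ) : Fin d → ℤ :=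
  a + ∑ i ∈ Finset.range k, x i

/-- The inner boundary `H_n` of the range `{S_0, …, S_n}` of a path `S`. -/
def innerBoundary {d : ℕ} (S : ℕ → Fin d → ℤ) (n : ℕ) : Set (Fin d → ℤ) :=
  {z | ∃ i ≤ n, z = S i ∧ ¬ neighbors (S i) ⊆ S '' {m | m ≤ n}}

/-- The number `L_n` of points of the inner boundary (a finite set). -/
noncomputable def boundaryCount {d : ℕ} (S : ℕ → Fin d → ℤ) (n : ℕ) : ℕ :=
  (innerBoundary S n).ncard

/-- The pairs of paths `(S, S')` such that `{S_m : m ≥ 0} ∪ {S'_m : m ≥ 0}` does not contain all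
neighbours of the origin and `S` is not at the origin at any time `m ≥ 1`. -/
def escapeEvent (d : ℕ) : Set ((ℕ → Fin d → ℤ) × (ℕ → Fin d → ℤ)) :=
  {p | ¬ neighbors 0 ⊆ Set.range p.1 ∪ Set.range p.2 ∧ ∀ m, 1 ≤ m → p.1 m ≠ 0}

/-- The constant `q`: the probability of `escapeEvent` for the pair `(S, S')`, where `S` is the
walk started from the origin with increments `X` and `S'` is an independent copy of `-S`; that is,
the law of the pair is the product of the law of `S` and the law of `-S` on path space. -/
noncomputable def boundaryRate {d : ℕ} {Ω : Type*} [MeasurableSpace Ω] (P : Measure Ω)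
    (X : ℕ → Ω → Fin d → ℤ) : ℝ :=
  ((P.map fun ω k => walk 0 (fun i => X i ω) k).prod
    (P.map fun ω k => -walk 0 (fun i => X i ω) k)).real (escapeEvent d)

end RangeBoundary

/-!
Counting each boundary point at its last visit, `L_n` is the number of times `s ≤ n` such that
`S_s` is not visited again and has a neighbour not visited at all, up to time `n`. Seen from `S_s`,
the walk after and before time `s` is a two-sided walk whose halves are distributed as the two
independent walks in the definition of `q`. Extend the increments to an i.i.d. sequence indexed by
`ℤ`; let `E` be the escape event for the two-sided walk, and `E_K` the same event with times
restricted to `[0, K]`. Every visit of the shift to `E` is a time counted in `L_n`, and every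
counted time in `[K, n - K]` is a visit to `E_K`. By Birkhoff's theorem for the ergodic shift the
visits to `E` and `E_K` have frequencies `P(E) = q` and `P(E_K)`, and `P(E_K)` decreases to `q`
because the origin has finitely many neighbours.

Birkhoff's theorem is derived from the maximal ergodic theorem; the shift is ergodic because an
invariant set is approximated by cylinders, which are independent of their remote translates.
-/

namespace RangeBoundary

section ErgodicTheorem

variable {α : Type*} {T : α → α} {f : α → ℝ}

lemma partialSups_birkhoffSum_nonneg (T : α → α) (f : α → ℝ) (n : ℕ) (x : α) :
    0 ≤ partialSups (birkhoffSum T f) n x :=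
  le_partialSups_of_le (birkhoffSum T f) n.zero_le x

lemma partialSups_birkhoffSum_le_add {n : ℕ} {x : α}
    (hpos : 0 < partialSups (birkhoffSum T f) n x) :
    partialSups (birkhoffSum T f) n x ≤ f x + partialSups (birkhoffSum T f) n (T x) := by
  obtain ⟨k, hkn, hk⟩ := exists_partialSups_eq (fun k => birkhoffSum T f k x) n
  rw [← Pi.partialSups_apply] at hk
  rw [hk] at hpos ⊢
  obtain _ | k := k
  · simp at hpos
  · rw [birkhoffSum_succ']
    gcongr
    exact le_partialSups_of_le (birkhoffSum T f) (by lia : k ≤ n) (T x)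

lemma bddAbove_range_birkhoffSum_apply_iff (T : α → α) (f : α → ℝ) (x : α) :
    BddAbove (Set.range fun n => birkhoffSum T f n (T x)) ↔
      BddAbove (Set.range fun n => birkhoffSum T f n x) := by
  simp only [bddAbove_def, Set.forall_mem_range]
  constructor
  · rintro ⟨b, hb⟩
    refine ⟨max 0 (f x + b), fun n => ?_⟩
    obtain _ | n := n
    · simp
    · rw [birkhoffSum_succ']
      exact le_max_of_le_right (by linarith [hb n])
  · rintro ⟨b, hb⟩
    refine ⟨b - f x, fun n => ?_⟩
    have := hb (n + 1)
    rw [birkhoffSum_succ'] at this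
    linarith

lemma birkhoffSum_indicator_one (T : α → α) (A : Set α) (n : ℕ) (x : α) :
    birkhoffSum T (A.indicator (1 : α → ℝ)) n x = ({k | k < n ∧ T^[k] x ∈ A}.ncard : ℝ) := by
  classical
  have : {k | k < n ∧ T^[k] x ∈ A} = ((Finset.range n).filter fun k => T^[k] x ∈ A : Finset ℕ) := by
    ext; simp
  rw [this, Set.ncard_coe_finset]
  simp [birkhoffSum, Set.indicator_apply]

variable [MeasurableSpace α] {μ : Measure α}

lemma integrable_birkhoffSum (hT : MeasurePreserving T μ μ) (hf : Integrable f μ) (n : ℕ) :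
    Integrable (birkhoffSum T f n) μ :=
  integrable_finsetSum _ fun k _ => (hT.iterate k).integrable_comp_of_integrable hf

lemma integrable_partialSups_birkhoffSum (hT : MeasurePreserving T μ μ) (hf : Integrable f μ)
    (n : ℕ) : Integrable (partialSups (birkhoffSum T f) n) μ := by
  induction n with
  | zero => simpa only [partialSups_zero] using integrable_birkhoffSum hT hf 0
  | succ n ih =>
    rw [← Order.succ_eq_add_one, partialSups_succ]
    exact ih.sup (integrable_birkhoffSum hT hf (n + 1))

-- Garsia's argument: the maximum `M` of the partial sums satisfies `M ≤ f + M ∘ T` where it is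
-- positive, and `M` and `M ∘ T` have the same integral.
lemma setIntegral_nonneg_of_partialSups_birkhoffSum_pos (hT : MeasurePreserving T μ μ)
    (hf : Integrable f μ) (n : ℕ) :
    0 ≤ ∫ x in {x | 0 < partialSups (birkhoffSum T f) n x}, f x ∂μ := by
  set M := partialSups (birkhoffSum T f) n
  set A := {x | 0 < M x}
  have hM : Integrable M μ := integrable_partialSups_birkhoffSum hT hf n
  have hM0 : 0 ≤ M := partialSups_birkhoffSum_nonneg T f n
  have hMT : Integrable (M ∘ T) μ := hT.integrable_comp_of_integrable hM
  have hA : NullMeasurableSet A μ := nullMeasurableSet_lt aemeasurable_const hM.aemeasurable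
  have hle : ∫ x, M x ∂μ ≤ ∫ x in A, f x ∂μ + ∫ x, M x ∂μ :=
    calc ∫ x, M x ∂μ = ∫ x in A, M x ∂μ :=
          (setIntegral_eq_integral_of_forall_compl_eq_zero fun x hx =>
            le_antisymm (not_lt.1 hx) (hM0 x)).symm
      _ ≤ ∫ x in A, (f x + M (T x)) ∂μ :=
          setIntegral_mono_on₀ hM.integrableOn (hf.add hMT).integrableOn hA fun x hx =>
            partialSups_birkhoffSum_le_add hx
      _ = ∫ x in A, f x ∂μ + ∫ x in A, M (T x) ∂μ :=
          integral_add hf.integrableOn hMT.integrableOn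
      _ ≤ ∫ x in A, f x ∂μ + ∫ x, M (T x) ∂μ :=
          add_le_add le_rfl (setIntegral_le_integral hMT (ae_of_all _ fun x => hM0 (T x)))
      _ = ∫ x in A, f x ∂μ + ∫ x, M x ∂μ := by
          rw [← integral_map hT.aemeasurable (by rw [hT.map_eq]; exact hM.1), hT.map_eq]
  linarith

theorem setIntegral_nonneg_of_exists_birkhoffSum_pos (hT : MeasurePreserving T μ μ)
    (hf : Integrable f μ) : 0 ≤ ∫ x in {x | ∃ n, 0 < birkhoffSum T f n x}, f x ∂μ := by
  have hUnion : {x | ∃ n, 0 < birkhoffSum T f n x} =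
      ⋃ n, {x | 0 < partialSups (birkhoffSum T f) n x} := by
    ext x
    simp only [Set.mem_ofPred_eq, Set.mem_iUnion, Pi.partialSups_apply]
    refine ⟨fun ⟨n, hn⟩ => ⟨n, hn.trans_le (le_partialSups (fun k => birkhoffSum T f k x) n)⟩,
      fun ⟨n, hn⟩ => ?_⟩
    obtain ⟨k, -, hk⟩ := exists_partialSups_eq (fun k => birkhoffSum T f k x) n
    exact ⟨k, hn.trans_eq hk⟩
  rw [hUnion]
  refine ge_of_tendsto' (tendsto_setIntegral_of_monotone₀ (fun n => ?_) (fun m n hmn x hx => ?_)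
    hf.integrableOn) (setIntegral_nonneg_of_partialSups_birkhoffSum_pos hT hf)
  · exact nullMeasurableSet_lt aemeasurable_const
      (integrable_partialSups_birkhoffSum hT hf n).aemeasurable
  · exact hx.trans_le ((partialSups (birkhoffSum T f)).monotone hmn x)

lemma ae_bddAbove_range_birkhoffSum (hT : Ergodic T μ) (hf : Integrable f μ)
    (hneg : ∫ x, f x ∂μ < 0) : ∀ᵐ x ∂μ, BddAbove (Set.range fun n => birkhoffSum T f n x) := by
  set B := {x | BddAbove (Set.range fun n => birkhoffSum T f n x)}
  have hB : NullMeasurableSet B μ := by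
    have : B = ⋃ b : ℕ, ⋂ n, {x | birkhoffSum T f n x ≤ b} := by
      ext x
      simp only [B, bddAbove_def, Set.forall_mem_range, Set.mem_ofPred_eq, Set.mem_iUnion,
        Set.mem_iInter]
      exact ⟨fun ⟨b, hb⟩ => (exists_nat_ge b).imp fun c hc n => (hb n).trans hc,
        fun ⟨b, hb⟩ => ⟨b, hb⟩⟩
    rw [this]
    exact .iUnion fun b => .iInter fun n => nullMeasurableSet_le
      (integrable_birkhoffSum hT.toMeasurePreserving hf n).aemeasurable aemeasurable_const
  have hinv : T ⁻¹' B = B := Set.ext (bddAbove_range_birkhoffSum_apply_iff T f)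
  refine (hT.quasiErgodic.ae_mem_or_ae_notMem₀ hB hinv.eventuallyEq).resolve_right fun hunb => ?_
  have hfull : {x | ∃ n, 0 < birkhoffSum T f n x} =ᵐ[μ] Set.univ := by
    refine eventuallyEq_univ.2 (hunb.mono fun x hx => ?_)
    by_contra! hle
    exact hx ⟨0, Set.forall_mem_range.2 hle⟩
  have := setIntegral_nonneg_of_exists_birkhoffSum_pos hT.toMeasurePreserving hf
  rw [setIntegral_congr_set hfull, setIntegral_univ] at this
  exact hneg.not_ge this

variable [IsProbabilityMeasure μ]

lemma ae_eventually_birkhoffAverage_lt (hT : Ergodic T μ) (hf : Integrable f μ) {c : ℝ}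
    (hc : ∫ x, f x ∂μ < c) : ∀ᵐ x ∂μ, ∀ᶠ n in atTop, birkhoffAverage ℝ T f n x < c := by
  obtain ⟨b, hfb, hbc⟩ := exists_between hc
  have hneg : ∫ x, (f x - b) ∂μ < 0 := by
    simpa [integral_sub hf (integrable_const b)] using hfb
  filter_upwards [ae_bddAbove_range_birkhoffSum hT (hf.sub (integrable_const b)) hneg] with x hx
  obtain ⟨C, hC⟩ := hx
  have hlim : Tendsto (fun n : ℕ => C / n + b) atTop (𝓝 b) := by
    simpa using (tendsto_const_div_atTop_nhds_zero_nat C).add_const b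
  filter_upwards [hlim.eventually_lt_const hbc, eventually_gt_atTop 0] with n hn hn0
  have hsum : birkhoffSum T f n x - n * b ≤ C := by
    simpa [birkhoffSum, Finset.sum_sub_distrib] using hC (Set.mem_range_self n)
  refine lt_of_le_of_lt ?_ hn
  have : (0 : ℝ) < n := by exact_mod_cast hn0
  rw [birkhoffAverage, smul_eq_mul, inv_mul_le_iff₀ this, mul_add, mul_div_cancel₀ _ this.ne']
  linarith

theorem ae_tendsto_birkhoffAverage (hT : Ergodic T μ) (hf : Integrable f μ) :
    ∀ᵐ x ∂μ, Tendsto (birkhoffAverage ℝ T f · x) atTop (𝓝 (∫ x, f x ∂μ)) := by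
  have hupper : ∀ᵐ x ∂μ, ∀ c : ℚ, ∫ x, f x ∂μ < c →
      ∀ᶠ n in atTop, birkhoffAverage ℝ T f n x < c :=
    ae_all_iff.2 fun c => ae_all_iff.2 fun hc => ae_eventually_birkhoffAverage_lt hT hf hc
  have hlower : ∀ᵐ x ∂μ, ∀ c : ℚ, c < ∫ x, f x ∂μ →
      ∀ᶠ n in atTop, c < birkhoffAverage ℝ T f n x := by
    refine ae_all_iff.2 fun c => ae_all_iff.2 fun hc => ?_
    have hneg : ∫ x, (-f) x ∂μ < -c := by simpa [integral_neg] using hc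
    filter_upwards [ae_eventually_birkhoffAverage_lt hT hf.neg hneg] with x hx
    filter_upwards [hx] with n hn
    simpa [birkhoffAverage_neg] using hn
  filter_upwards [hupper, hlower] with x hxu hxl
  refine tendsto_order.2 ⟨fun b hb => ?_, fun b hb => ?_⟩
  · obtain ⟨c, hbc, hc⟩ := exists_rat_btwn hb
    exact (hxl c hc).mono fun n => hbc.trans
  · obtain ⟨c, hc, hcb⟩ := exists_rat_btwn hb
    exact (hxu c hc).mono fun n h => h.trans hcb

theorem ae_tendsto_ncard_iterate_mem_div (hT : Ergodic T μ) {A : Set α} (hA : MeasurableSet A) :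
    ∀ᵐ x ∂μ, Tendsto (fun n : ℕ => ({k | k < n ∧ T^[k] x ∈ A}.ncard : ℝ) / n) atTop
      (𝓝 (μ.real A)) := by
  have hint : Integrable (A.indicator (1 : α → ℝ)) μ := (integrable_const 1).indicator hA
  filter_upwards [ae_tendsto_birkhoffAverage hT hint] with x hx
  simpa only [birkhoffAverage, birkhoffSum_indicator_one, smul_eq_mul, inv_mul_eq_div,
    integral_indicator_one hA] using hx

end ErgodicTheorem

section Independence

variable {Ω ι κ κ' E : Type*} [MeasurableSpace E]

lemma comap_reindex_le (X : ι → Ω → E) (σ : κ → ι) :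
    MeasurableSpace.comap (fun ω k => X (σ k) ω) MeasurableSpace.pi ≤
      ⨆ i ∈ Set.range σ, MeasurableSpace.comap (X i) inferInstance := by
  rw [← measurable_iff_comap_le]
  refine @measurable_pi_lambda _ _ _ (_) _ _ fun k => ?_
  rw [measurable_iff_comap_le]
  exact le_iSup₂_of_le (σ k) ⟨k, rfl⟩ le_rfl

lemma indepFun_reindex [MeasurableSpace Ω] {μ : Measure Ω} {X : ι → Ω → E} (hX : iIndepFun X μ)
    (hmeas : ∀ i, Measurable (X i)) {σ : κ → ι} {τ : κ' → ι}
    (h : Disjoint (Set.range σ) (Set.range τ)) :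
    IndepFun (fun ω k => X (σ k) ω) (fun ω k => X (τ k) ω) μ :=
  indep_of_indep_of_le_left (indep_of_indep_of_le_right
    (indep_iSup_of_disjoint (fun i => (hmeas i).comap_le) hX h) (comap_reindex_le X τ))
    (comap_reindex_le X σ)

lemma indepFun_reindex_infinitePi (ν : Measure E) [IsProbabilityMeasure ν] {σ : κ → ι}
    {τ : κ' → ι} (h : Disjoint (Set.range σ) (Set.range τ)) :
    IndepFun (fun (x : ι → E) k => x (σ k)) (fun x k => x (τ k))
      (Measure.infinitePi fun _ => ν) :=
  indepFun_reindex (iIndepFun_infinitePi (X := fun _ x => x) fun _ => measurable_id)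
    measurable_pi_apply h

end Independence

section Ergodicity

open scoped symmDiff

section Mixing

variable {α : Type*} [MeasurableSpace α] {μ : Measure α} {T : α → α}

lemma abs_measureReal_sub_measureReal_inter_le [IsFiniteMeasure μ] {A B C : Set α}
    (hA : MeasurableSet A) (hB : MeasurableSet B) (hC : MeasurableSet C) :
    |μ.real A - μ.real (B ∩ C)| ≤ μ.real (A ∆ B) + μ.real (A ∆ C) := by
  have hsub : A ∆ (B ∩ C) ⊆ A ∆ B ∪ A ∆ C := by
    intro x
    simp only [Set.mem_symmDiff, Set.mem_inter_iff, Set.mem_union]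
    tauto
  calc |μ.real A - μ.real (B ∩ C)| ≤ μ.real (A ∆ (B ∩ C)) :=
        abs_measureReal_sub_le_measureReal_symmDiff hA.nullMeasurableSet
          (hB.inter hC).nullMeasurableSet
    _ ≤ μ.real (A ∆ B ∪ A ∆ C) := measureReal_mono hsub
    _ ≤ μ.real (A ∆ B) + μ.real (A ∆ C) := measureReal_union_le _ _

lemma measureReal_symmDiff_preimage_iterate (hT : MeasurePreserving T μ μ) {A C : Set α}
    (hA : MeasurableSet A) (hC : MeasurableSet C) (hinv : T ⁻¹' A = A) (n : ℕ) :
    μ.real (A ∆ (T^[n] ⁻¹' C)) = μ.real (A ∆ C) := by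
  have hinvn : T^[n] ⁻¹' A = A := by
    rw [Set.preimage_iterate_eq]
    exact Function.iterate_fixed hinv n
  conv_lhs => rw [← hinvn]
  rw [← Set.preimage_symmDiff]
  exact (hT.iterate n).measureReal_preimage (hA.symmDiff hC).nullMeasurableSet

variable [IsProbabilityMeasure μ]

lemma measureReal_eq_sq_of_approx (hT : MeasurePreserving T μ μ) {A : Set α}
    (hA : MeasurableSet A) (hinv : T ⁻¹' A = A)
    (happrox : ∀ ε : ℝ, 0 < ε → ∃ C, MeasurableSet C ∧ μ.real (A ∆ C) < ε ∧
      ∃ n, μ.real (C ∩ T^[n] ⁻¹' C) = μ.real C ^ 2) :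
    μ.real A = μ.real A ^ 2 := by
  refine eq_of_forall_dist_le fun ε hε => ?_
  obtain ⟨C, hC, hAC, n, hn⟩ := happrox (ε / 4) (by positivity)
  have hlin : |μ.real A - μ.real C ^ 2| ≤ 2 * μ.real (A ∆ C) := by
    rw [← hn, two_mul]
    nth_rewrite 2 [← measureReal_symmDiff_preimage_iterate hT hA hC hinv n]
    exact abs_measureReal_sub_measureReal_inter_le hA hC ((hT.iterate n).measurable hC)
  have hsq : |μ.real C ^ 2 - μ.real A ^ 2| ≤ 2 * μ.real (A ∆ C) :=
    calc |μ.real C ^ 2 - μ.real A ^ 2| = (μ.real C + μ.real A) * |μ.real A - μ.real C| := by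
          rw [sq_sub_sq, abs_mul, abs_of_nonneg (by positivity), abs_sub_comm]
      _ ≤ (1 + 1) * μ.real (A ∆ C) := by
          gcongr
          · exact measureReal_le_one
          · exact measureReal_le_one
          · exact abs_measureReal_sub_le_measureReal_symmDiff hA.nullMeasurableSet
              hC.nullMeasurableSet
      _ = 2 * μ.real (A ∆ C) := by norm_num
  rw [Real.dist_eq]
  linarith [abs_sub_le (μ.real A) (μ.real C ^ 2) (μ.real A ^ 2)]

lemma ergodic_of_approx (hT : MeasurePreserving T μ μ)
    (happrox : ∀ A, MeasurableSet A → ∀ ε : ℝ, 0 < ε → ∃ C, MeasurableSet C ∧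
      μ.real (A ∆ C) < ε ∧ ∃ n, μ.real (C ∩ T^[n] ⁻¹' C) = μ.real C ^ 2) :
    Ergodic T μ := by
  refine ⟨hT, ⟨fun A hA hinv => eventuallyConst_set'.2 ?_⟩⟩
  have hsq := measureReal_eq_sq_of_approx hT hA hinv (happrox A hA)
  rw [ae_eq_empty, ae_eq_univ_iff_measure_eq hA.nullMeasurableSet, measure_univ,
    ← measureReal_eq_zero_iff, ← ENNReal.toReal_eq_one_iff, ← measureReal_def]
  rcases mul_eq_zero.1 (show μ.real A * (1 - μ.real A) = 0 by linarith) with h | h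
  · exact .inl h
  · exact .inr (by linarith)

end Mixing

section Bernoulli

variable {ι E : Type*}

lemma reindex_iterate (τ : ι → ι) (n : ℕ) (x : ι → E) :
    (fun (x : ι → E) i => x (τ i))^[n] x = fun i => x (τ^[n] i) := by
  induction n generalizing x with
  | zero => rfl
  | succ n ih =>
    rw [Function.iterate_succ_apply, ih]
    simp only [Function.iterate_succ_apply']

variable {τ : ι → ι} [MeasurableSpace E] (ν : Measure E) [IsProbabilityMeasure ν]

lemma measurePreserving_reindex (hτ : Function.Injective τ) :
    MeasurePreserving (fun (x : ι → E) i => x (τ i)) (Measure.infinitePi fun _ => ν)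
      (Measure.infinitePi fun _ => ν) :=
  ⟨by fun_prop, Measure.map_infinitePi_infinitePi_of_inj hτ⟩

lemma measureReal_cylinder_inter_preimage_iterate (hτ : Function.Injective τ) {s : Finset ι}
    {S : Set (s → E)} (hS : MeasurableSet S) {n : ℕ} (hn : ∀ i ∈ s, τ^[n] i ∉ s) :
    (Measure.infinitePi fun _ : ι => ν).real
      (cylinder s S ∩ (fun (x : ι → E) i => x (τ i))^[n] ⁻¹' cylinder s S) =
      (Measure.infinitePi fun _ : ι => ν).real (cylinder s S) ^ 2 := by
  have hdisj : Disjoint (Set.range fun i : s => (i : ι)) (Set.range fun i : s => τ^[n] i) := by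
    rw [Set.disjoint_left]
    rintro _ ⟨i, rfl⟩ ⟨j, hj⟩
    exact hn j j.2 (Set.mem_of_eq_of_mem hj i.2)
  have hindep := indepFun_reindex_infinitePi ν hdisj
  have hpre : (fun (x : ι → E) i => x (τ i))^[n] ⁻¹' cylinder s S =
      (fun (x : ι → E) (i : s) => x (τ^[n] i)) ⁻¹' S := by
    ext x
    simp only [Set.mem_preimage, mem_cylinder, reindex_iterate]
    rfl
  have hinv := ((measurePreserving_reindex ν hτ).iterate n).measureReal_preimage
    (hS.cylinder s).nullMeasurableSet
  rw [sq]
  nth_rewrite 2 [← hinv]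
  rw [hpre]
  simp only [measureReal_def, ← ENNReal.toReal_mul]
  exact congrArg _ (hindep.measure_inter_preimage_eq_mul _ _ hS hS)

theorem ergodic_reindex (hτ : Function.Injective τ)
    (hwander : ∀ s : Finset ι, ∃ n, ∀ i ∈ s, τ^[n] i ∉ s) :
    Ergodic (fun (x : ι → E) i => x (τ i)) (Measure.infinitePi fun _ => ν) := by
  refine ergodic_of_approx (measurePreserving_reindex ν hτ) fun A hA ε hε => ?_
  obtain ⟨C, hC, hAC⟩ := exists_measure_symmDiff_lt_of_generateFrom_isSetRing
    (μ := Measure.infinitePi fun _ : ι => ν) isSetRing_measurableCylinders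
    ⟨{Set.univ}, Set.countable_singleton _,
      Set.singleton_subset_iff.2 (univ_mem_measurableCylinders _), by simp⟩
    generateFrom_measurableCylinders.symm hA (ENNReal.ofReal_pos.2 hε)
  obtain ⟨s, S, hS, rfl⟩ := (mem_measurableCylinders C).1 hC
  obtain ⟨n, hn⟩ := hwander s
  refine ⟨cylinder s S, hS.cylinder s, ?_, n,
    measureReal_cylinder_inter_preimage_iterate ν hτ hS hn⟩
  rw [symmDiff_comm, measureReal_def]
  exact ENNReal.toReal_lt_of_lt_ofReal hAC

end Bernoulli

section Shift

variable {E : Type*}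

/-- The left shift of a two-sided sequence. -/
def shift (y : ℤ → E) : ℤ → E := fun k => y (k + 1)

lemma shift_iterate_apply (n : ℕ) (y : ℤ → E) (k : ℤ) : shift^[n] y k = y (k + n) := by
  induction n generalizing y with
  | zero => simp
  | succ n ih =>
    rw [Function.iterate_succ_apply, ih, shift]
    push_cast
    ring_nf

lemma ergodic_shift [MeasurableSpace E] (ν : Measure E) [IsProbabilityMeasure ν] :
    Ergodic shift (Measure.infinitePi fun _ : ℤ => ν) := by
  refine ergodic_reindex ν (add_left_injective 1) fun s => ?_
  obtain ⟨b, hb⟩ := s.bddAbove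
  obtain ⟨c, hc⟩ := s.bddBelow
  refine ⟨(b - c + 1).toNat, fun i hi hmem => ?_⟩
  simp only [add_right_iterate, nsmul_eq_mul, mul_one] at hmem
  have := hb hmem
  have := hc hi
  lia

end Shift

end Ergodicity

section Paths

variable {d : ℕ}

lemma mem_neighbors_iff_sub_mem {a z : Fin d → ℤ} : z ∈ neighbors a ↔ z - a ∈ neighbors 0 := by
  simp [neighbors]

lemma finite_neighbors_zero : (neighbors (0 : Fin d → ℤ)).Finite := by
  refine (Set.Finite.pi' fun _ => Set.finite_Icc (-1 : ℤ) 1).subset fun z hz i => ?_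
  have hsum : ∑ i, |z i| = 1 := by simpa [neighbors] using hz
  have hi : |z i| ≤ ∑ i, |z i| :=
    Finset.single_le_sum (fun j _ => abs_nonneg (z j)) (Finset.mem_univ i)
  exact abs_le.1 (hi.trans hsum.le)

/-- The times `i ≤ n` at which the path `S` visits a point of its inner boundary at time `n` for
the last time up to time `n`. -/
def lastBoundaryTimes (S : ℕ → Fin d → ℤ) (n : ℕ) : Set ℕ :=
  {i | i ≤ n ∧ ¬ neighbors (S i) ⊆ S '' {m | m ≤ n} ∧ ∀ m, i < m → m ≤ n → S m ≠ S i}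

lemma exists_last_visit {β : Type*} (S : ℕ → β) {i n : ℕ} (hi : i ≤ n) :
    ∃ j ≤ n, S j = S i ∧ ∀ m, j < m → m ≤ n → S m ≠ S i := by
  classical
  exact ⟨_, Nat.findGreatest_le n, Nat.findGreatest_spec (P := fun j => S j = S i) hi rfl,
    fun m => Nat.findGreatest_is_greatest⟩

lemma image_lastBoundaryTimes (S : ℕ → Fin d → ℤ) (n : ℕ) :
    S '' lastBoundaryTimes S n = innerBoundary S n := by
  ext z
  constructor
  · rintro ⟨i, ⟨hi, hbd, -⟩, rfl⟩
    exact ⟨i, hi, rfl, hbd⟩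
  · rintro ⟨i, hi, rfl, hbd⟩
    obtain ⟨j, hj, hji, hlast⟩ := exists_last_visit S hi
    exact ⟨j, ⟨hj, by rwa [hji], by rwa [hji]⟩, hji⟩

lemma injOn_lastBoundaryTimes (S : ℕ → Fin d → ℤ) (n : ℕ) :
    Set.InjOn S (lastBoundaryTimes S n) := by
  rintro i ⟨hi, -, hlast_i⟩ j ⟨hj, -, hlast_j⟩ hij
  refine le_antisymm (not_lt.1 fun hlt => ?_) (not_lt.1 fun hlt => ?_)
  · exact hlast_j i hlt hi hij
  · exact hlast_i j hlt hj hij.symm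

lemma boundaryCount_eq_ncard_lastBoundaryTimes (S : ℕ → Fin d → ℤ) (n : ℕ) :
    boundaryCount S n = (lastBoundaryTimes S n).ncard := by
  rw [boundaryCount, ← image_lastBoundaryTimes, (injOn_lastBoundaryTimes S n).ncard_image]

lemma boundaryCount_congr {S S' : ℕ → Fin d → ℤ} {n : ℕ} (h : ∀ m ≤ n, S m = S' m) :
    boundaryCount S n = boundaryCount S' n := by
  have himage : S '' {m | m ≤ n} = S' '' {m | m ≤ n} := Set.image_congr h
  unfold boundaryCount innerBoundary
  congr 1
  ext z
  exact exists_congr fun i => and_congr_right fun hi => by rw [h i hi, himage]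

/-- The pairs of paths for which the conditions in `escapeEvent` hold up to time `K`. -/
def escapeUpTo (d K : ℕ) : Set ((ℕ → Fin d → ℤ) × (ℕ → Fin d → ℤ)) :=
  {p | (∃ z ∈ neighbors 0, ∀ m ≤ K, p.1 m ≠ z ∧ p.2 m ≠ z) ∧ ∀ m, 1 ≤ m → m ≤ K → p.1 m ≠ 0}

lemma antitone_escapeUpTo : Antitone (escapeUpTo d) := fun _ _ hKL _ ⟨⟨z, hz, havoid⟩, hret⟩ =>
  ⟨⟨z, hz, fun m hm => havoid m (hm.trans hKL)⟩, fun m h1 hm => hret m h1 (hm.trans hKL)⟩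

lemma iInter_escapeUpTo : ⋂ K, escapeUpTo d K = escapeEvent d := by
  ext p
  simp only [Set.mem_iInter]
  constructor
  · refine fun h => ⟨fun hsub => ?_, fun m hm => (h m).2 m hm le_rfl⟩
    have hvisit : ∀ z ∈ neighbors 0, ∃ m, p.1 m = z ∨ p.2 m = z := fun z hz =>
      (hsub hz).elim (fun ⟨m, hm⟩ => ⟨m, .inl hm⟩) fun ⟨m, hm⟩ => ⟨m, .inr hm⟩
    choose! m hm using hvisit
    obtain ⟨K, hK⟩ := (finite_neighbors_zero.image m).bddAbove
    obtain ⟨z, hz, havoid⟩ := (h K).1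
    have := havoid (m z) (hK (Set.mem_image_of_mem m hz))
    exact (hm z hz).elim this.1 this.2
  · rintro ⟨hsub, hret⟩ K
    obtain ⟨z, hz, havoid⟩ := Set.not_subset.1 hsub
    simp only [Set.mem_union, Set.mem_range, not_or, not_exists] at havoid
    exact ⟨⟨z, hz, fun m _ => ⟨havoid.1 m, havoid.2 m⟩⟩, fun m hm _ => hret m hm⟩

/-- The paths from the origin, forward and backward in time, of the walk with increments `y`
indexed by `ℤ`: the increment of the forward path at step `k` is `y k`, that of the backward path
is `-y (-(k + 1))`. -/
def twoSidedWalk (y : ℤ → Fin d → ℤ) : (ℕ → Fin d → ℤ) × (ℕ → Fin d → ℤ) :=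
  (walk 0 fun k => y k, -walk 0 fun k => y (Int.negSucc k))

variable (a : Fin d → ℤ) (y : ℤ → Fin d → ℤ)

lemma walk_add_eq_forward (s m : ℕ) :
    walk a (fun k => y k) (s + m) =
      walk a (fun k => y k) s + (twoSidedWalk (shift^[s] y)).1 m := by
  simp [walk, twoSidedWalk, shift_iterate_apply, Finset.sum_range_add, add_assoc, add_comm (s : ℤ)]

lemma walk_eq_backward (s m : ℕ) :
    walk a (fun k => y k) s =
      walk a (fun k => y k) (s + m) + (twoSidedWalk (shift^[s + m] y)).2 m := by
  have hback : ∑ k ∈ Finset.range m, shift^[s + m] y (Int.negSucc k) =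
      ∑ k ∈ Finset.range m, y ↑(s + k) := by
    rw [← Finset.sum_range_reflect]
    refine Finset.sum_congr rfl fun k hk => ?_
    rw [shift_iterate_apply]
    congr 1
    have := Finset.mem_range.1 hk
    lia
  simp [walk, twoSidedWalk, hback, Finset.sum_range_add, add_assoc]

lemma ncard_escapeEvent_le_boundaryCount (n : ℕ) :
    {s | s < n ∧ shift^[s] y ∈ twoSidedWalk ⁻¹' escapeEvent d}.ncard ≤
      boundaryCount (walk a fun k => y k) n := by
  rw [boundaryCount_eq_ncard_lastBoundaryTimes]
  refine Set.ncard_le_ncard (fun s ⟨hs, hsub, hret⟩ => ⟨hs.le, ?_, fun m hsm _ heq => ?_⟩)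
    ((Set.finite_Iic n).subset fun s hs => hs.1)
  · obtain ⟨z, hz, havoid⟩ := Set.not_subset.1 hsub
    simp only [Set.mem_union, Set.mem_range, not_or, not_exists] at havoid
    refine Set.not_subset.2 ⟨walk a (fun k => y k) s + z,
      mem_neighbors_iff_sub_mem.2 (by rwa [add_sub_cancel_left]), ?_⟩
    rintro ⟨m, -, hm⟩
    rcases le_total s m with hsm | hms
    · obtain ⟨k, rfl⟩ := Nat.exists_eq_add_of_le hsm
      rw [walk_add_eq_forward, add_right_inj] at hm
      exact havoid.1 k hm
    · obtain ⟨k, rfl⟩ := Nat.exists_eq_add_of_le hms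
      rw [walk_eq_backward a y m k, add_right_inj] at hm
      exact havoid.2 k hm
  · obtain ⟨k, rfl⟩ := Nat.exists_eq_add_of_le hsm.le
    rw [walk_add_eq_forward, add_eq_left] at heq
    exact hret k (by lia) heq

lemma mem_escapeUpTo_of_mem_lastBoundaryTimes {K n s : ℕ} (hKs : K ≤ s) (hsn : s + K ≤ n)
    (hs : s ∈ lastBoundaryTimes (walk a fun k => y k) n) :
    twoSidedWalk (shift^[s] y) ∈ escapeUpTo d K := by
  obtain ⟨-, hsub, hlast⟩ := hs
  obtain ⟨z, hz, havoid⟩ := Set.not_subset.1 hsub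
  simp only [Set.mem_image, Set.mem_ofPred_eq, not_exists, not_and] at havoid
  refine ⟨⟨z - walk a (fun k => y k) s, mem_neighbors_iff_sub_mem.1 hz, fun m hm =>
    ⟨fun heq => havoid (s + m) (by lia) ?_, fun heq => havoid (s - m) (by lia) ?_⟩⟩,
    fun m h1 hm heq => hlast (s + m) (by lia) (by lia) ?_⟩
  · rw [walk_add_eq_forward, heq, add_sub_cancel]
  · rw [walk_eq_backward a y (s - m) m, Nat.sub_add_cancel (hm.trans hKs), heq, add_sub_cancel]
  · rw [walk_add_eq_forward, heq, add_zero]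

lemma boundaryCount_le_ncard_escapeUpTo_add (K n : ℕ) :
    boundaryCount (walk a fun k => y k) n ≤
      {s | s < n ∧ shift^[s] y ∈ twoSidedWalk ⁻¹' escapeUpTo d K}.ncard + (2 * K + 1) := by
  set B := {s | s < n ∧ shift^[s] y ∈ twoSidedWalk ⁻¹' escapeUpTo d K}
  have hB : B.Finite := (Set.finite_Iio n).subset fun s hs => hs.1
  have hsub : lastBoundaryTimes (walk a fun k => y k) n ⊆
      B ∪ ↑(Finset.range K ∪ Finset.Icc (n - K) n) := by
    intro s hs
    by_contra! hmem
    simp only [Set.mem_union, Finset.mem_coe, Finset.mem_union, Finset.mem_range,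
      Finset.mem_Icc, not_or, not_and, not_le, not_lt] at hmem
    have hsn := hs.1
    exact hmem.1 ⟨by lia, mem_escapeUpTo_of_mem_lastBoundaryTimes a y hmem.2.1 (by lia) hs⟩
  rw [boundaryCount_eq_ncard_lastBoundaryTimes]
  calc (lastBoundaryTimes (walk a fun k => y k) n).ncard
      ≤ (B ∪ ↑(Finset.range K ∪ Finset.Icc (n - K) n)).ncard :=
        Set.ncard_le_ncard hsub (hB.union (Finset.finite_toSet _))
    _ ≤ B.ncard + (Finset.range K ∪ Finset.Icc (n - K) n).card := by
        rw [← Set.ncard_coe_finset]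
        exact Set.ncard_union_le _ _
    _ ≤ B.ncard + (2 * K + 1) := by
        gcongr
        refine (Finset.card_union_le _ _).trans ?_
        rw [Finset.card_range, Nat.card_Icc]
        lia

lemma tendsto_boundaryCount_div_of_tendsto_frequency {q : ℝ} {r : ℕ → ℝ}
    (hr : Tendsto r atTop (𝓝 q))
    (hescape : Tendsto (fun n : ℕ =>
      ({s | s < n ∧ shift^[s] y ∈ twoSidedWalk ⁻¹' escapeEvent d}.ncard : ℝ) / n) atTop (𝓝 q))
    (hescapeUpTo : ∀ K, Tendsto (fun n : ℕ =>
      ({s | s < n ∧ shift^[s] y ∈ twoSidedWalk ⁻¹' escapeUpTo d K}.ncard : ℝ) / n) atTop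
      (𝓝 (r K))) :
    Tendsto (fun n : ℕ => (boundaryCount (walk a fun k => y k) n : ℝ) / n) atTop (𝓝 q) := by
  refine tendsto_order.2 ⟨fun b hb => ?_, fun b hb => ?_⟩
  · filter_upwards [hescape.eventually_const_lt hb] with n hn
    refine hn.trans_le ?_
    gcongr
    exact ncard_escapeEvent_le_boundaryCount a y n
  · obtain ⟨K, hK⟩ := (hr.eventually_lt_const hb).exists
    have hlim := (hescapeUpTo K).add (tendsto_const_div_atTop_nhds_zero_nat (2 * K + 1 : ℝ))
    rw [add_zero] at hlim
    filter_upwards [hlim.eventually_lt_const hK] with n hn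
    refine lt_of_le_of_lt ?_ hn
    rw [← add_div]
    gcongr
    exact_mod_cast boundaryCount_le_ncard_escapeUpTo_add a y K n

end Paths

section Measurability

variable {d : ℕ}

lemma measurable_walk (a : Fin d → ℤ) : Measurable (walk a) := by
  unfold walk
  fun_prop

lemma measurable_twoSidedWalk : Measurable (twoSidedWalk (d := d)) := by
  unfold twoSidedWalk
  have := measurable_walk (0 : Fin d → ℤ)
  fun_prop

lemma measurableSet_escapeUpTo (K : ℕ) : MeasurableSet (escapeUpTo d K) := by
  unfold escapeUpTo
  measurability

lemma measurableSet_escapeEvent : MeasurableSet (escapeEvent d) :=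
  iInter_escapeUpTo (d := d) ▸ .iInter measurableSet_escapeUpTo

lemma tendsto_measureReal_escapeUpTo
    (μ : Measure ((ℕ → Fin d → ℤ) × (ℕ → Fin d → ℤ))) [IsFiniteMeasure μ] :
    Tendsto (fun K => μ.real (escapeUpTo d K)) atTop (𝓝 (μ.real (escapeEvent d))) := by
  rw [← iInter_escapeUpTo]
  exact (ENNReal.tendsto_toReal (measure_ne_top _ _)).comp <| tendsto_measure_iInter_atTop
    (fun K => (measurableSet_escapeUpTo K).nullMeasurableSet) antitone_escapeUpTo
    ⟨0, measure_ne_top _ _⟩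

lemma measurable_boundaryCount (n : ℕ) :
    Measurable fun S : ℕ → Fin d → ℤ => boundaryCount S n := by
  let extend : (Finset.Iic n → Fin d → ℤ) → ℕ → Fin d → ℤ := fun u m =>
    if h : m ∈ Finset.Iic n then u ⟨m, h⟩ else 0
  have hfactor : (fun S : ℕ → Fin d → ℤ => boundaryCount S n) =
      (fun u => boundaryCount (extend u) n) ∘ (Finset.Iic n).restrict := by
    ext S
    exact boundaryCount_congr fun m hm => by simp [extend, hm]
  rw [hfactor]
  exact (measurable_of_countable _).comp (Finset.measurable_restrict _)

lemma measurableSet_tendsto_boundaryCount_div (a : Fin d → ℤ) (q : ℝ) :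
    MeasurableSet
      {x | Tendsto (fun n : ℕ => (boundaryCount (walk a x) n : ℝ) / n) atTop (𝓝 q)} := by
  refine measurableSet_tendsto _ fun n => ?_
  have := (measurable_boundaryCount n).comp (measurable_walk a)
  exact (measurable_from_top.comp this).div_const _

end Measurability

section Law

variable {d : ℕ}

lemma map_eq_infinitePi_of_iid {Ω ι E : Type*} [MeasurableSpace Ω] [MeasurableSpace E]
    {P : Measure Ω} {X : ι → Ω → E} (i₀ : ι)
    (hmeas : ∀ i, Measurable (X i)) (hindep : iIndepFun X P)
    (hident : ∀ i, IdentDistrib (X i) (X i₀) P P) :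
    P.map (fun ω i => X i ω) = Measure.infinitePi fun _ => P.map (X i₀) := by
  have := hindep.isProbabilityMeasure
  rw [hindep.map_fun_eq_infinitePi_map hmeas]
  exact congrArg _ (funext fun i => (hident i).map_eq)

lemma boundaryRate_eq_boundaryRate_map {Ω : Type*} [MeasurableSpace Ω] (P : Measure Ω)
    {X : ℕ → Ω → Fin d → ℤ} (hmeas : ∀ i, Measurable (X i)) :
    boundaryRate P X = boundaryRate (P.map fun ω i => X i ω) fun i x => x i := by
  have hX : Measurable fun ω i => X i ω := measurable_pi_lambda _ hmeas
  have hwalk := measurable_walk (0 : Fin d → ℤ)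
  have hneg : Measurable fun x : ℕ → Fin d → ℤ => -walk 0 x := hwalk.neg
  exact congrArg (Measure.real · _) <| congrArg₂ Measure.prod
    (Measure.map_map hwalk hX).symm (Measure.map_map hneg hX).symm

variable (ν : Measure (Fin d → ℤ)) [IsProbabilityMeasure ν]

lemma map_twoSidedWalk : (Measure.infinitePi fun _ : ℤ => ν).map twoSidedWalk =
    ((Measure.infinitePi fun _ : ℕ => ν).map (walk 0)).prod
      ((Measure.infinitePi fun _ : ℕ => ν).map fun x => -walk 0 x) := by
  have hwalk := measurable_walk (0 : Fin d → ℤ)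
  have hfut : Measurable fun (y : ℤ → Fin d → ℤ) (k : ℕ) => y k := by fun_prop
  have hpast : Measurable fun (y : ℤ → Fin d → ℤ) (k : ℕ) => y (Int.negSucc k) := by fun_prop
  have hdisj : Disjoint (Set.range fun k : ℕ => (k : ℤ)) (Set.range Int.negSucc) := by
    rw [Set.disjoint_left]
    rintro _ ⟨i, rfl⟩ ⟨j, hj⟩
    lia
  have hindep := (indepFun_reindex_infinitePi ν hdisj).comp hwalk hwalk.neg
  have hprod := (indepFun_iff_map_prod_eq_prod_map_map (hwalk.comp hfut).aemeasurable
    (hwalk.neg.comp hpast).aemeasurable).1 hindep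
  rw [← Measure.map_map hwalk hfut, ← Measure.map_map hwalk.neg hpast,
    Measure.map_infinitePi_infinitePi_of_inj Nat.cast_injective,
    Measure.map_infinitePi_infinitePi_of_inj fun i j => Int.negSucc.inj] at hprod
  exact hprod

lemma measureReal_map_twoSidedWalk_escapeEvent :
    ((Measure.infinitePi fun _ : ℤ => ν).map twoSidedWalk).real (escapeEvent d) =
      boundaryRate (Measure.infinitePi fun _ : ℕ => ν) fun i x => x i := by
  rw [map_twoSidedWalk]
  rfl

end Law

section Limit

variable {d : ℕ} (ν : Measure (Fin d → ℤ)) [IsProbabilityMeasure ν]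

theorem ae_tendsto_boundaryCount_div_twoSided (a : Fin d → ℤ) :
    ∀ᵐ y ∂(Measure.infinitePi fun _ : ℤ => ν),
      Tendsto (fun n : ℕ => (boundaryCount (walk a fun k => y k) n : ℝ) / n) atTop
        (𝓝 (boundaryRate (Measure.infinitePi fun _ : ℕ => ν) fun i x => x i)) := by
  rw [← measureReal_map_twoSidedWalk_escapeEvent]
  set μ := Measure.infinitePi fun _ : ℤ => ν
  have : IsProbabilityMeasure (μ.map twoSidedWalk) :=
    Measure.isProbabilityMeasure_map measurable_twoSidedWalk.aemeasurable
  have hfreq {A : Set ((ℕ → Fin d → ℤ) × (ℕ → Fin d → ℤ))} (hA : MeasurableSet A) :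
      ∀ᵐ y ∂μ, Tendsto (fun n : ℕ =>
        ({s | s < n ∧ shift^[s] y ∈ twoSidedWalk ⁻¹' A}.ncard : ℝ) / n) atTop
        (𝓝 ((μ.map twoSidedWalk).real A)) := by
    rw [map_measureReal_apply measurable_twoSidedWalk hA]
    exact ae_tendsto_ncard_iterate_mem_div (ergodic_shift ν) (measurable_twoSidedWalk hA)
  filter_upwards [hfreq measurableSet_escapeEvent,
    ae_all_iff.2 fun K => hfreq (measurableSet_escapeUpTo K)] with y hescape hescapeUpTo
  exact tendsto_boundaryCount_div_of_tendsto_frequency a y (tendsto_measureReal_escapeUpTo _)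
    hescape hescapeUpTo

theorem ae_tendsto_boundaryCount_div (a : Fin d → ℤ) :
    ∀ᵐ x ∂(Measure.infinitePi fun _ : ℕ => ν),
      Tendsto (fun n : ℕ => (boundaryCount (walk a x) n : ℝ) / n) atTop
        (𝓝 (boundaryRate (Measure.infinitePi fun _ : ℕ => ν) fun i x => x i)) := by
  have hrestrict : Measurable fun (y : ℤ → Fin d → ℤ) (k : ℕ) => y k := by fun_prop
  have hmap : (Measure.infinitePi fun _ : ℤ => ν).map (fun y (k : ℕ) => y k) =
      Measure.infinitePi fun _ : ℕ => ν :=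
    Measure.map_infinitePi_infinitePi_of_inj Nat.cast_injective
  rw [← hmap, ae_map_iff hrestrict.aemeasurable (measurableSet_tendsto_boundaryCount_div a _), hmap]
  exact ae_tendsto_boundaryCount_div_twoSided ν a

end Limit

end RangeBoundary

theorem theorem1 {d : ℕ} (hd : 1 ≤ d) {Ω : Type*} [MeasurableSpace Ω] (P : Measure Ω)
    [IsProbabilityMeasure P] (X : ℕ → Ω → Fin d → ℤ) (hmeas : ∀ i, Measurable (X i))
    (hindep : iIndepFun X P) (hident : ∀ i, IdentDistrib (X i) (X 0) P P) (a : Fin d → ℤ) :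
    ∀ᵐ ω ∂P, Tendsto
      (fun n : ℕ =>
        (RangeBoundary.boundaryCount (RangeBoundary.walk a (fun i => X i ω)) n : ℝ) / (n : ℝ))
      atTop (𝓝 (RangeBoundary.boundaryRate P X)) := by
  have hX : Measurable fun ω i => X i ω := measurable_pi_lambda _ hmeas
  have hν : IsProbabilityMeasure (P.map (X 0)) :=
    Measure.isProbabilityMeasure_map (hmeas 0).aemeasurable
  have hlaw : P.map (fun ω i => X i ω) = Measure.infinitePi fun _ => P.map (X 0) :=
    RangeBoundary.map_eq_infinitePi_of_iid 0 hmeas hindep hident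
  rw [RangeBoundary.boundaryRate_eq_boundaryRate_map P hmeas]
  have hlim := RangeBoundary.ae_tendsto_boundaryCount_div (P.map (X 0)) a
  rw [← hlaw] at hlim
  exact ae_of_ae_map hX.aemeasurable hlim
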